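/- Let $1\le k\le n$, let $\mathbb{S}^n$ be the space of real symmetric $n\times n$ matrices with inner product $\langle A,B\rangle=\mathrm{Tr}(AB)$ and Frobenius norm $\|\cdot\|_F$, and let $\mathcal{F}_{n,k}=\{X\in\mathbb{S}^n : 0\preceq X\preceq I,\ \mathrm{Tr}(X)=k\}$ (the Fantope). Let $f:\mathbb{S}^n\to\mathbb{R}$ be convex and differentiable with $\|\nabla f(X)-\nabla f(Y)\|_F\le\beta\|X-Y\|_F$ for all $X,Y\in\mathbb{S}^n$, where $\beta>0$ and $\nabla f(X)\in\mathbb{S}^n$. Let $X^*\in\mathcal{F}_{n,k}$ be a minimizer of $f$ over $\mathcal{F}_{n,k}$, let $\mu_1\ge\mu_2\ge\dots\ge\mu_n$ be the eigenvalues of $-\nabla f(X^*)$, and suppose that there is an index $j\in\{k,\dots,n-1\}$ with $\mu_j-\mu_{j+1}>0$; let $r$ be the smallest such index. Then $\mathrm{rank}(X^*)\le r$. Moreover, let $r'\in\{r,\dots,n-1\}$, let $X_1\in\mathcal{F}_{n,k}$ satisfy $\|X_1-X^*\|_F\le\frac{\mu_k-\mu_{r'+1}}{4\beta}$, and let $X_{t+1}=\Pi_{\mathcal{F}_{n,k}}\big[X_t-\beta^{-1}\nabla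 f(X_t)\big]$ for $t\ge1$, where $\Pi_{\mathcal{F}_{n,k}}$ is the Euclidean (Frobenius) projection onto $\mathcal{F}_{n,k}$. Then: 1. For all $t\ge1$, $\mathrm{rank}(X_{t+1})\le r'$, and $X_{t+1}$ is determined by $r'$ leading eigenpairs of $Y_t=X_t-\beta^{-1}\nabla f(X_t)$: if $Y_t=\sum_{i=1}^n\gamma_iu_iu_i^\top$ with $u_1,\dots,u_n$ orthonormal and $\gamma_1\ge\dots\ge\gamma_n$, then the equation $\sum_{i=1}^{r'}\min(\max(\gamma_i-\theta,0),1)=k$ has a solution $\theta\in\mathbb{R}$, and for each solution $\theta$ one has $X_{t+1}=\sum_{i=1}^{r'}\min(\max(\gamma_i-\theta,0),1)\,u_iu_i^\top$. 2. For all $t\ge2$, $f(X_t)-f(X^*)\le C\,\beta\|X_1-X^*\|_F^2/t$, where $C>0$ is an absolute constant (independent of $n$, $k$, $\beta$, $f$, $X^*$, $r'$ and the iterates). -/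

import Mathlib

open scoped Matrix.Norms.Frobenius

/-- The space of real symmetric `n × n` matrices, as a subset of all `n × n` matrices.
All matrix norms below are Frobenius norms. -/
def symMatrices (n : ℕ) : Set (Matrix (Fin n) (Fin n) ℝ) :=
  {X | X.IsSymm}

/-- The Fantope: symmetric matrices `X` with `0 ⪯ X ⪯ I` and trace `k`. -/
def fantope (n k : ℕ) : Set (Matrix (Fin n) (Fin n) ℝ) :=
  {X | X.IsSymm ∧ X.PosSemidef ∧ (1 - X).PosSemidef ∧ X.trace = (k : ℝ)}

/-- The continuous linear functional `H ↦ ⟨G, H⟩ = Tr (Gᵀ H)`. -/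
noncomputable def traceInner {n : ℕ} (G : Matrix (Fin n) (Fin n) ℝ) :
    Matrix (Fin n) (Fin n) ℝ →L[ℝ] ℝ :=
  LinearMap.toContinuousLinearMap
    ((Matrix.traceLinearMap (Fin n) ℝ ℝ).comp (LinearMap.mulLeft ℝ G.transpose))

/-- `G` is the gradient of `f` over the space of symmetric matrices: at each symmetric `X` the
matrix `G X` is symmetric and represents the Fréchet derivative of `f` along symmetric matrices.
These conditions determine `G X` uniquely. -/
def IsSymGradient {n : ℕ} (f : Matrix (Fin n) (Fin n) ℝ → ℝ)
    (G : Matrix (Fin n) (Fin n) ℝ → Matrix (Fin n) (Fin n) ℝ) : Prop :=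
  ∀ X ∈ symMatrices n, (G X).IsSymm ∧ HasFDerivWithinAt f (traceInner (G X)) (symMatrices n) X

/-- `P` is a Euclidean (Frobenius) projection of `Y` onto the set `S`. -/
def IsProjOnto {n : ℕ} (S : Set (Matrix (Fin n) (Fin n) ℝ)) (Y P : Matrix (Fin n) (Fin n) ℝ) :
    Prop :=
  P ∈ S ∧ ∀ Z ∈ S, ‖Y - P‖ ≤ ‖Y - Z‖

/-- `A = ∑ γ_i u_i u_iᵀ` with `γ_1 ≥ ⋯ ≥ γ_n` and `u` an orthonormal basis. The sequence `γ` is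
indexed from `1`; only `γ 1, …, γ n` matter, and `γ (i + 1)` belongs to the vector `u i`. -/
def IsEigenDecomp {n : ℕ} (A : Matrix (Fin n) (Fin n) ℝ) (γ : ℕ → ℝ)
    (u : OrthonormalBasis (Fin n) ℝ (EuclideanSpace ℝ (Fin n))) : Prop :=
  AntitoneOn γ (Set.Icc 1 n) ∧
    A = ∑ i : Fin n, γ ((i : ℕ) + 1) • Matrix.vecMulVec (u i).ofLp (u i).ofLp

/-- `μ 1 ≥ ⋯ ≥ μ n` are the eigenvalues of `A`, counted with multiplicity. -/
def AreEigenvalues {n : ℕ} (A : Matrix (Fin n) (Fin n) ℝ) (μ : ℕ → ℝ) : Prop :=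
  ∃ u, IsEigenDecomp A μ u

/-- The clipped shifted eigenvalue `min (max (x - θ) 0) 1`. -/
noncomputable def clipShift (θ x : ℝ) : ℝ := min (max (x - θ) 0) 1

/-- `P`, as the projection of `Y` onto the Fantope of trace `k`, is computed from `s` leading
eigenpairs of `Y` alone: for each ordered eigendecomposition `Y = ∑ γ_i u_i u_iᵀ` the scalar
equation `∑_{i ≤ s} min (max (γ_i - θ) 0) 1 = k` has a solution `θ`, and every solution gives
`P = ∑_{i ≤ s} min (max (γ_i - θ) 0) 1 • u_i u_iᵀ`. -/
def ComputedFromLeading {n : ℕ} (k s : ℕ) (Y P : Matrix (Fin n) (Fin n) ℝ) : Prop :=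
  ∀ (γ : ℕ → ℝ) (u : OrthonormalBasis (Fin n) ℝ (EuclideanSpace ℝ (Fin n))),
    IsEigenDecomp Y γ u →
      (∃ θ : ℝ, ∑ i ∈ Finset.univ.filter (fun i : Fin n => (i : ℕ) + 1 ≤ s), clipShift θ (γ ((i : ℕ) + 1)) = (k : ℝ)) ∧
      ∀ θ : ℝ, ∑ i ∈ Finset.univ.filter (fun i : Fin n => (i : ℕ) + 1 ≤ s), clipShift θ (γ ((i : ℕ) + 1)) = (k : ℝ) →
        P = ∑ i ∈ Finset.univ.filter (fun i : Fin n => (i : ℕ) + 1 ≤ s),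
          clipShift θ (γ ((i : ℕ) + 1)) • Matrix.vecMulVec (u i).ofLp (u i).ofLp

/-! The rank bounds come from one exchange argument. Let `P` maximize `⟨M, ·⟩` over the Fantope,
with `M` near a matrix `A` such that `μ k > μ (s + 1)`. If `rank P > s ≥ k`, the trace condition
gives `rank (1 - P) > n - k`. By dimension count `range P` then contains a unit `w` orthogonal to
the top `s` eigenvectors of `A`, and `range (1 - P)` a unit `z` in the span of the top `k`. Moving
`P` along `zzᵀ - wwᵀ` stays in the Fantope for a short while and increases `⟨M, ·⟩`, a contradiction
(`rank_le_of_traceInner_le`).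

Take `A = -∇f(X*)`. First-order optimality gives the case `M = A`, `P = X*`. An iterate `X_{t+1}`
maximizes `⟨M, ·⟩` for the residual `M = β (Y_t - X_{t+1})`, and `‖A - M‖ ≤ 2β ‖X_t - X*‖`
(`norm_residual_le`). Distances to `X*` never exceed the initial one, so this is at most half the
gap at every step.

Projection clips shifted eigenvalues, so low rank means that the trailing ones are clipped to zero.
The rate is the standard potential argument. -/

/-! ### The Frobenius inner product. -/

lemma traceInner_apply {n : ℕ} (A B : Matrix (Fin n) (Fin n) ℝ) :
    traceInner A B = ∑ i, ∑ j, A i j * B i j := by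
  change (A.transpose * B).trace = _
  rw [Finset.sum_comm]
  simp [Matrix.trace, Matrix.mul_apply]

lemma traceInner_comm {n : ℕ} (A B : Matrix (Fin n) (Fin n) ℝ) :
    traceInner A B = traceInner B A := by
  simp only [traceInner_apply, mul_comm]

lemma traceInner_sub_left {n : ℕ} (A B C : Matrix (Fin n) (Fin n) ℝ) :
    traceInner (A - B) C = traceInner A C - traceInner B C := by
  rw [traceInner_comm, map_sub, traceInner_comm C A, traceInner_comm C B]

lemma traceInner_add_left {n : ℕ} (A B C : Matrix (Fin n) (Fin n) ℝ) :
    traceInner (A + B) C = traceInner A C + traceInner B C := by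
  rw [traceInner_comm, map_add, traceInner_comm C A, traceInner_comm C B]

lemma traceInner_smul_left {n : ℕ} (c : ℝ) (A C : Matrix (Fin n) (Fin n) ℝ) :
    traceInner (c • A) C = c * traceInner A C := by
  rw [traceInner_comm, map_smul, traceInner_comm C A, smul_eq_mul]

lemma traceInner_neg_left {n : ℕ} (A C : Matrix (Fin n) (Fin n) ℝ) :
    traceInner (-A) C = - traceInner A C := by
  rw [traceInner_comm, map_neg, traceInner_comm C A]

lemma traceInner_self {n : ℕ} (A : Matrix (Fin n) (Fin n) ℝ) :
    traceInner A A = ‖A‖ ^ 2 := by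
  have h : (0 : ℝ) ≤ ∑ i, ∑ j, ‖A i j‖ ^ (2 : ℝ) := by positivity
  rw [Matrix.frobenius_norm_def, ← Real.sqrt_eq_rpow, Real.sq_sqrt h, traceInner_apply]
  refine Finset.sum_congr rfl fun i _ => Finset.sum_congr rfl fun j _ => ?_
  rw [Real.rpow_two, Real.norm_eq_abs, sq_abs, sq]

lemma sq_norm_add {n : ℕ} (A B : Matrix (Fin n) (Fin n) ℝ) :
    ‖A + B‖ ^ 2 = ‖A‖ ^ 2 + 2 * traceInner A B + ‖B‖ ^ 2 := by
  simp only [← traceInner_self, map_add, traceInner_add_left, traceInner_comm B A]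
  ring

lemma sq_norm_sub {n : ℕ} (A B : Matrix (Fin n) (Fin n) ℝ) :
    ‖A - B‖ ^ 2 = ‖A‖ ^ 2 - 2 * traceInner A B + ‖B‖ ^ 2 := by
  simp only [← traceInner_self, map_sub, traceInner_sub_left, traceInner_comm B A]
  ring

lemma traceInner_le_norm_mul_norm {n : ℕ} (A B : Matrix (Fin n) (Fin n) ℝ) :
    traceInner A B ≤ ‖A‖ * ‖B‖ := by
  have h1 := sq_norm_sub (‖B‖ • A) (‖A‖ • B)
  simp only [norm_smul, norm_norm, map_smul, traceInner_smul_left, smul_eq_mul] at h1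
  have h2 := sq_nonneg ‖‖B‖ • A - ‖A‖ • B‖
  rcases (norm_nonneg A).eq_or_lt with hA | hA
  · have : A = 0 := norm_eq_zero.mp hA.symm
    subst this
    simp [traceInner_apply]
  rcases (norm_nonneg B).eq_or_lt with hB | hB
  · have : B = 0 := norm_eq_zero.mp hB.symm
    subst this
    simp
  have h3 : ‖A‖ * ‖B‖ * traceInner A B ≤ ‖A‖ * ‖B‖ * (‖A‖ * ‖B‖) := by nlinarith
  exact le_of_mul_le_mul_left h3 (by positivity)

lemma traceInner_vecMulVec {n : ℕ} (A : Matrix (Fin n) (Fin n) ℝ) (x y : Fin n → ℝ) :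
    traceInner A (Matrix.vecMulVec x y) = x ⬝ᵥ A.mulVec y := by
  simp only [traceInner_apply, Matrix.vecMulVec_apply, dotProduct, Matrix.mulVec, Finset.mul_sum]
  refine Finset.sum_congr rfl fun i _ => Finset.sum_congr rfl fun j _ => by ring

lemma traceInner_one {n : ℕ} (A : Matrix (Fin n) (Fin n) ℝ) :
    traceInner 1 A = A.trace := by
  change ((1 : Matrix (Fin n) (Fin n) ℝ).transpose * A).trace = _
  simp

/-! ### First-order inequalities along segments. -/

lemma add_smul_mem_symMatrices {n : ℕ} {X H : Matrix (Fin n) (Fin n) ℝ}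
    (hX : X ∈ symMatrices n) (hH : H ∈ symMatrices n) (t : ℝ) :
    X + t • H ∈ symMatrices n :=
  Matrix.IsSymm.add hX (Matrix.IsSymm.smul hH t)

lemma sub_mem_symMatrices {n : ℕ} {X Y : Matrix (Fin n) (Fin n) ℝ}
    (hX : X ∈ symMatrices n) (hY : Y ∈ symMatrices n) :
    X - Y ∈ symMatrices n :=
  Matrix.IsSymm.sub hX hY

lemma IsSymGradient.hasDerivAt_line {n : ℕ} {f : Matrix (Fin n) (Fin n) ℝ → ℝ}
    {G : Matrix (Fin n) (Fin n) ℝ → Matrix (Fin n) (Fin n) ℝ} (hG : IsSymGradient f G)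
    {X H : Matrix (Fin n) (Fin n) ℝ} (hX : X ∈ symMatrices n) (hH : H ∈ symMatrices n) (t : ℝ) :
    HasDerivAt (fun s : ℝ => f (X + s • H)) (traceInner (G (X + t • H)) H) t := by
  have h1 := (hG _ (add_smul_mem_symMatrices hX hH t)).2
  have h2 : HasDerivAt (fun s : ℝ => X + s • H) H t := by
    exact (((hasDerivAt_id t).smul_const H).const_add X).congr_deriv (one_smul ℝ H)
  have h3 := h1.comp_hasDerivWithinAt t (h2.hasDerivWithinAt (s := Set.univ))
    (fun s _ => add_smul_mem_symMatrices hX hH s)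
  rwa [hasDerivWithinAt_univ] at h3

lemma deriv_nonneg_of_min_right {φ : ℝ → ℝ} {φ' : ℝ} (h : HasDerivAt φ φ' 0)
    (hmin : ∀ t ∈ Set.Icc (0 : ℝ) 1, φ 0 ≤ φ t) : 0 ≤ φ' := by
  have h1 := h.hasDerivWithinAt (s := Set.Ioi 0)
  rw [hasDerivWithinAt_iff_tendsto_slope' (by simp)] at h1
  refine ge_of_tendsto h1 ?_
  filter_upwards [Ioo_mem_nhdsGT (show (0 : ℝ) < 1 by norm_num)] with t ht
  rw [slope_def_field]
  exact div_nonneg (sub_nonneg.2 (hmin t ⟨ht.1.le, ht.2.le⟩)) (by linarith [ht.1])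

lemma IsSymGradient.add_traceInner_le {n : ℕ} {f : Matrix (Fin n) (Fin n) ℝ → ℝ}
    {G : Matrix (Fin n) (Fin n) ℝ → Matrix (Fin n) (Fin n) ℝ} (hG : IsSymGradient f G)
    (hf : ConvexOn ℝ (symMatrices n) f)
    {X Y : Matrix (Fin n) (Fin n) ℝ} (hX : X ∈ symMatrices n) (hY : Y ∈ symMatrices n) :
    f X + traceInner (G X) (Y - X) ≤ f Y := by
  have h1 := hG.hasDerivAt_line hX (sub_mem_symMatrices hY hX) 0
  rw [zero_smul, add_zero] at h1
  -- By convexity this function attains its minimum over `[0, 1]` at `t = 0`.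
  have h2 : HasDerivAt (fun t : ℝ => t * (f Y - f X) - f (X + t • (Y - X)))
      ((f Y - f X) - traceInner (G X) (Y - X)) 0 := by
    exact (((hasDerivAt_id (0 : ℝ)).mul_const (f Y - f X)).fun_sub h1).congr_deriv (by simp)
  have h3 := deriv_nonneg_of_min_right h2 ?_
  · linarith
  intro t ht
  have h4 := hf.2 hX hY (sub_nonneg.2 ht.2) ht.1 (by ring)
  have h5 : (1 - t) • X + t • Y = X + t • (Y - X) := by
    rw [sub_smul, smul_sub, one_smul]; abel
  rw [h5] at h4
  simp only [smul_eq_mul, zero_mul, zero_smul, add_zero] at h4 ⊢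
  linarith

lemma IsSymGradient.le_add_traceInner_add {n : ℕ} {f : Matrix (Fin n) (Fin n) ℝ → ℝ}
    {G : Matrix (Fin n) (Fin n) ℝ → Matrix (Fin n) (Fin n) ℝ} (hG : IsSymGradient f G) {β : ℝ}
    (hlip : ∀ X ∈ symMatrices n, ∀ Y ∈ symMatrices n, ‖G X - G Y‖ ≤ β * ‖X - Y‖)
    {X Y : Matrix (Fin n) (Fin n) ℝ} (hX : X ∈ symMatrices n) (hY : Y ∈ symMatrices n) :
    f Y ≤ f X + traceInner (G X) (Y - X) + β / 2 * ‖Y - X‖ ^ 2 := by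
  set H := Y - X with hHdef
  have hH : H ∈ symMatrices n := sub_mem_symMatrices hY hX
  -- Cauchy–Schwarz and the Lipschitz bound make `ψ' ≤ 0` on `(0, 1)`; the claim is `ψ 1 ≤ ψ 0`.
  let ψ : ℝ → ℝ := fun t => f (X + t • H) - t * traceInner (G X) H - t ^ 2 * (β / 2 * ‖H‖ ^ 2)
  have hψ : ∀ t, HasDerivAt ψ
      (traceInner (G (X + t • H)) H - traceInner (G X) H - 2 * t * (β / 2 * ‖H‖ ^ 2)) t := by
    intro t
    have h1 := hG.hasDerivAt_line hX hH t
    have h2 := (hasDerivAt_id t).mul_const (traceInner (G X) H)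
    have h3 := (hasDerivAt_pow 2 t).mul_const (β / 2 * ‖H‖ ^ 2)
    exact ((h1.fun_sub h2).fun_sub h3).congr_deriv (by simp)
  have hanti : AntitoneOn ψ (Set.Icc 0 1) := by
    refine antitoneOn_of_deriv_nonpos (convex_Icc 0 1)
      (fun t _ => (hψ t).continuousAt.continuousWithinAt)
      (fun t _ => (hψ t).differentiableAt.differentiableWithinAt) ?_
    intro t ht
    rw [interior_Icc] at ht
    rw [(hψ t).deriv, ← traceInner_sub_left]
    have h1 := traceInner_le_norm_mul_norm (G (X + t • H) - G X) H
    have h2 := hlip _ (add_smul_mem_symMatrices hX hH t) _ hX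
    rw [add_sub_cancel_left, norm_smul, Real.norm_of_nonneg ht.1.le] at h2
    have h3 := mul_le_mul_of_nonneg_right h2 (norm_nonneg H)
    nlinarith
  have h := hanti (Set.left_mem_Icc.2 zero_le_one) (Set.right_mem_Icc.2 zero_le_one) zero_le_one
  have hY' : X + (1 : ℝ) • H = Y := by rw [one_smul, hHdef]; abel
  simp only [ψ, hY', zero_smul, add_zero] at h
  linarith

/-! ### Variational inequalities for minimizers and projections. -/

lemma convex_fantope (n k : ℕ) : Convex ℝ (fantope n k) := by
  rintro X ⟨hX1, hX2, hX3, hX4⟩ Y ⟨hY1, hY2, hY3, hY4⟩ a b ha hb hab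
  refine ⟨(hX1.smul a).add (hY1.smul b), (hX2.smul ha).add (hY2.smul hb), ?_, ?_⟩
  · have : 1 - (a • X + b • Y) = a • (1 - X) + b • (1 - Y) := by
      have : (1 : Matrix (Fin n) (Fin n) ℝ) = a • 1 + b • 1 := by rw [← add_smul, hab, one_smul]
      rw [smul_sub, smul_sub]
      nth_rewrite 1 [this]
      abel
    rw [this]
    exact (hX3.smul ha).add (hY3.smul hb)
  · rw [Matrix.trace_add, Matrix.trace_smul, Matrix.trace_smul, hX4, hY4, ← add_smul, hab, one_smul]

lemma IsSymGradient.traceInner_nonneg_of_isMinOn {n : ℕ} {f : Matrix (Fin n) (Fin n) ℝ → ℝ}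
    {G : Matrix (Fin n) (Fin n) ℝ → Matrix (Fin n) (Fin n) ℝ} (hG : IsSymGradient f G)
    {S : Set (Matrix (Fin n) (Fin n) ℝ)} (hS : Convex ℝ S) (hSs : S ⊆ symMatrices n)
    {X Y : Matrix (Fin n) (Fin n) ℝ} (hmin : IsMinOn f S X) (hX : X ∈ S) (hY : Y ∈ S) :
    0 ≤ traceInner (G X) (Y - X) := by
  have h1 := hG.hasDerivAt_line (hSs hX) (sub_mem_symMatrices (hSs hY) (hSs hX)) 0
  rw [zero_smul, add_zero] at h1
  refine deriv_nonneg_of_min_right h1 fun t ht => ?_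
  rw [zero_smul, add_zero]
  exact hmin (hS.add_smul_sub_mem hX hY ht)

lemma IsProjOnto.traceInner_nonpos {n : ℕ} {S : Set (Matrix (Fin n) (Fin n) ℝ)}
    {Y P Z : Matrix (Fin n) (Fin n) ℝ} (hP : IsProjOnto S Y P) (hS : Convex ℝ S) (hZ : Z ∈ S) :
    traceInner (Y - P) (Z - P) ≤ 0 := by
  -- This is `‖Y - P - t (Z - P)‖² - ‖Y - P‖²`, which is minimal at `t = 0` on `[0, 1]`.
  have h : HasDerivAt (fun t : ℝ => t ^ 2 * ‖Z - P‖ ^ 2 - t * (2 * traceInner (Y - P) (Z - P)))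
      (-(2 * traceInner (Y - P) (Z - P))) 0 := by
    exact (((hasDerivAt_pow 2 (0 : ℝ)).mul_const (‖Z - P‖ ^ 2)).fun_sub
      ((hasDerivAt_id (0 : ℝ)).mul_const (2 * traceInner (Y - P) (Z - P)))).congr_deriv (by simp)
  have h1 := deriv_nonneg_of_min_right h fun t ht => ?_
  · linarith
  have h2 := hP.2 _ (hS.add_smul_sub_mem hP.1 hZ ht)
  have h3 := pow_le_pow_left₀ (norm_nonneg _) h2 2
  rw [← sub_sub, sq_norm_sub (Y - P), norm_smul, map_smul, mul_pow, Real.norm_eq_abs, sq_abs,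
    smul_eq_mul] at h3
  nlinarith

lemma IsProjOnto.eq_of_traceInner_nonpos {n : ℕ} {S : Set (Matrix (Fin n) (Fin n) ℝ)}
    {Y P Q : Matrix (Fin n) (Fin n) ℝ} (hP : IsProjOnto S Y P) (hQ : Q ∈ S)
    (h : ∀ Z ∈ S, traceInner (Y - Q) (Z - Q) ≤ 0) : P = Q := by
  have h1 := pow_le_pow_left₀ (norm_nonneg _) (hP.2 Q hQ) 2
  have h2 := h P hP.1
  have h3 := sq_norm_sub (Y - Q) (P - Q)
  rw [sub_sub_sub_cancel_right] at h3
  have h4 : ‖P - Q‖ = 0 := by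
    have := sq_nonneg ‖P - Q‖
    exact pow_eq_zero_iff two_ne_zero |>.1 (by linarith)
  exact sub_eq_zero.1 (norm_eq_zero.1 h4)

lemma fantope_subset_symMatrices (n k : ℕ) : fantope n k ⊆ symMatrices n := fun _ h => h.1

/-! ### Projected gradient descent. -/

/-- One step of projected gradient descent with step size `β⁻¹`. -/
lemma IsProjOnto.gradient_step_le {n : ℕ} {f : Matrix (Fin n) (Fin n) ℝ → ℝ}
    {G : Matrix (Fin n) (Fin n) ℝ → Matrix (Fin n) (Fin n) ℝ} (hG : IsSymGradient f G)
    (hf : ConvexOn ℝ (symMatrices n) f) {β : ℝ} (hβ : 0 < β)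
    (hlip : ∀ X ∈ symMatrices n, ∀ Y ∈ symMatrices n, ‖G X - G Y‖ ≤ β * ‖X - Y‖)
    {S : Set (Matrix (Fin n) (Fin n) ℝ)} (hS : Convex ℝ S) (hSs : S ⊆ symMatrices n)
    {X P Z : Matrix (Fin n) (Fin n) ℝ} (hX : X ∈ S) (hZ : Z ∈ S)
    (hP : IsProjOnto S (X - β⁻¹ • G X) P) :
    f P ≤ f Z + β / 2 * (‖X - Z‖ ^ 2 - ‖P - Z‖ ^ 2) := by
  have h1 := hG.le_add_traceInner_add hlip (hSs hX) (hSs hP.1)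
  have h2 := hG.add_traceInner_le hf (hSs hX) (hSs hZ)
  have h3 := hP.traceInner_nonpos hS hZ
  have h4 : traceInner (X - β⁻¹ • G X - P) (Z - P)
      = traceInner (X - P) (Z - P) - β⁻¹ * traceInner (G X) (Z - P) := by
    rw [← traceInner_smul_left, ← traceInner_sub_left, sub_right_comm]
  have h5 := sq_norm_sub (X - P) (Z - P)
  rw [sub_sub_sub_cancel_right] at h5
  have h6 : traceInner (G X) (P - X) = traceInner (G X) (Z - X) - traceInner (G X) (Z - P) := by
    rw [← map_sub, sub_sub_sub_cancel_left]
  have h7 : β * traceInner (X - P) (Z - P) ≤ traceInner (G X) (Z - P) := by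
    rw [h4] at h3
    have := mul_le_mul_of_nonneg_left h3 hβ.le
    rw [mul_sub, ← mul_assoc, mul_inv_cancel₀ hβ.ne', one_mul] at this
    linarith
  rw [norm_sub_rev P X, h6] at h1
  rw [norm_sub_rev P Z, h5]
  nlinarith

/-- The potential on the left does not increase with `t`. It yields both the rate and, since `f` is
minimal at `Xs`, the bound of all distances to `Xs` by the initial one. -/
lemma projected_gradient_potential_le {n : ℕ} {f : Matrix (Fin n) (Fin n) ℝ → ℝ}
    {G : Matrix (Fin n) (Fin n) ℝ → Matrix (Fin n) (Fin n) ℝ} (hG : IsSymGradient f G)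
    (hf : ConvexOn ℝ (symMatrices n) f) {β : ℝ} (hβ : 0 < β)
    (hlip : ∀ X ∈ symMatrices n, ∀ Y ∈ symMatrices n, ‖G X - G Y‖ ≤ β * ‖X - Y‖)
    {S : Set (Matrix (Fin n) (Fin n) ℝ)} (hS : Convex ℝ S) (hSs : S ⊆ symMatrices n)
    {Xs : Matrix (Fin n) (Fin n) ℝ} (hXs : Xs ∈ S) {X : ℕ → Matrix (Fin n) (Fin n) ℝ}
    (hX1 : X 1 ∈ S) (hX : ∀ t : ℕ, 1 ≤ t → IsProjOnto S (X t - β⁻¹ • G (X t)) (X (t + 1)))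
    (t : ℕ) :
    X (t + 1) ∈ S ∧
      t * (f (X (t + 1)) - f Xs) + β / 2 * ‖X (t + 1) - Xs‖ ^ 2 ≤ β / 2 * ‖X 1 - Xs‖ ^ 2 := by
  induction t with
  | zero => simpa using hX1
  | succ t ih =>
    have hP := hX (t + 1) (by omega)
    have h1 := hP.gradient_step_le hG hf hβ hlip hS hSs ih.1 hXs
    -- Comparing with the current iterate itself gives monotone descent.
    have h2 := hP.gradient_step_le hG hf hβ hlip hS hSs ih.1 ih.1
    rw [sub_self, norm_zero] at h2
    have h3 : f (X (t + 1 + 1)) ≤ f (X (t + 1)) := by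
      have := mul_nonneg hβ.le (sq_nonneg ‖X (t + 1 + 1) - X (t + 1)‖)
      linarith
    refine ⟨hP.1, ?_⟩
    have h4 := mul_le_mul_of_nonneg_left h3 (Nat.cast_nonneg (α := ℝ) t)
    have := ih.2
    push_cast
    linarith

/-! ### The exchange argument bounding the rank. -/

lemma isSymm_vecMulVec_self {n : ℕ} (x : Fin n → ℝ) : (Matrix.vecMulVec x x).IsSymm := by
  ext i j
  simp [Matrix.vecMulVec_apply, mul_comm]

lemma posSemidef_vecMulVec_self {n : ℕ} (x : Fin n → ℝ) : (Matrix.vecMulVec x x).PosSemidef := by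
  simpa using Matrix.posSemidef_vecMulVec_self_star x

lemma dotProduct_vecMulVec_self_mulVec {n : ℕ} (x y : Fin n → ℝ) :
    y ⬝ᵥ (Matrix.vecMulVec x x).mulVec y = (x ⬝ᵥ y) ^ 2 := by
  rw [Matrix.vecMulVec_mulVec, op_smul_eq_smul, dotProduct_smul, smul_eq_mul, dotProduct_comm y x,
    sq]

/-- Cauchy–Schwarz for the form of `Q`: a small rank-one piece can be removed in any direction of
its range. -/
lemma Matrix.PosSemidef.sub_smul_vecMulVec_mulVec {n : ℕ} {Q : Matrix (Fin n) (Fin n) ℝ}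
    (hQ : Q.PosSemidef) (v : Fin n → ℝ) {ε : ℝ} (hε : ε * (v ⬝ᵥ Q.mulVec v + 1) ≤ 1) :
    (Q - ε • Matrix.vecMulVec (Q.mulVec v) (Q.mulVec v)).PosSemidef := by
  have hsym : Q.IsSymm := by simpa [Matrix.IsHermitian, Matrix.IsSymm] using hQ.1
  refine Matrix.PosSemidef.of_dotProduct_mulVec_nonneg ?_ fun x => ?_
  · exact hQ.1.sub (by simp [Matrix.IsHermitian])
  set c := v ⬝ᵥ Q.mulVec v with hc
  set a := Q.mulVec v ⬝ᵥ x with ha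
  have hc0 : 0 ≤ c := by simpa using hQ.dotProduct_mulVec_nonneg v
  have h1 : ∀ t : ℝ, 0 ≤ x ⬝ᵥ Q.mulVec x + 2 * t * a + t ^ 2 * c := by
    intro t
    have h2 := hQ.dotProduct_mulVec_nonneg (x + t • v)
    have h3 : v ⬝ᵥ Q.mulVec x = a := by
      rw [Matrix.dotProduct_mulVec, ← Matrix.mulVec_transpose, hsym.eq]
    have h4 : x ⬝ᵥ Q.mulVec v = a := dotProduct_comm _ _
    simp only [star_trivial, Matrix.mulVec_add, Matrix.mulVec_smul, add_dotProduct, dotProduct_add,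
      smul_dotProduct, dotProduct_smul, smul_eq_mul, h3, h4] at h2
    linarith
  -- The form of `Q` evaluated at `x - ε a v`.
  have h2 := h1 (-(ε * a))
  rw [star_trivial, Matrix.sub_mulVec, Matrix.smul_mulVec, dotProduct_sub, dotProduct_smul,
    dotProduct_vecMulVec_self_mulVec, smul_eq_mul, ← ha]
  rcases le_total ε 0 with h | h
  · have h5 : 0 ≤ x ⬝ᵥ Q.mulVec x := by simpa using hQ.dotProduct_mulVec_nonneg x
    nlinarith [mul_nonneg (neg_nonneg.2 h) (sq_nonneg a)]
  · have h5 : 0 ≤ ε * a ^ 2 * (1 - ε * (c + 1)) :=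
      mul_nonneg (mul_nonneg h (sq_nonneg a)) (by linarith)
    nlinarith [mul_nonneg (sq_nonneg ε) (sq_nonneg a)]

/-- The range of a matrix of rank larger than `#S` contains a unit vector orthogonal to the
vectors `u i` with `i ∈ S`. -/
lemma exists_mulVec_orthogonal {n : ℕ} (Q : Matrix (Fin n) (Fin n) ℝ) (u : Fin n → Fin n → ℝ)
    (S : Finset (Fin n)) (h : S.card < Q.rank) :
    ∃ v : Fin n → ℝ, Q.mulVec v ⬝ᵥ Q.mulVec v = 1 ∧ ∀ i ∈ S, u i ⬝ᵥ Q.mulVec v = 0 := by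
  let φ : (Fin n → ℝ) →ₗ[ℝ] (S → ℝ) :=
    { toFun := fun w i => u i ⬝ᵥ w
      map_add' := fun x y => by ext i; simp [dotProduct_add]
      map_smul' := fun c x => by ext i; simp [dotProduct_smul] }
  have h1 : LinearMap.ker (φ.comp (LinearMap.range Q.mulVecLin).subtype) ≠ ⊥ := by
    apply LinearMap.ker_ne_bot_of_finrank_lt
    rw [Module.finrank_fintype_fun_eq_card, Fintype.card_coe]
    exact h
  obtain ⟨⟨w, v, rfl⟩, hw, hw0⟩ := Submodule.exists_mem_ne_zero_of_ne_bot h1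
  have hw0' : Q.mulVec v ≠ 0 := fun h0 => hw0 (Subtype.ext h0)
  have hpos : 0 < Q.mulVec v ⬝ᵥ Q.mulVec v := by
    have h2 : 0 ≤ Q.mulVec v ⬝ᵥ Q.mulVec v := Finset.sum_nonneg fun i _ => mul_self_nonneg _
    exact h2.lt_of_ne fun h3 => hw0' (dotProduct_self_eq_zero.1 h3.symm)
  refine ⟨(Real.sqrt (Q.mulVec v ⬝ᵥ Q.mulVec v))⁻¹ • v, ?_, fun i hi => ?_⟩
  · rw [Matrix.mulVec_smul, smul_dotProduct, dotProduct_smul, smul_eq_mul, smul_eq_mul,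
      ← mul_assoc, ← mul_inv, Real.mul_self_sqrt hpos.le, inv_mul_cancel₀ hpos.ne']
  · have := congrFun (LinearMap.mem_ker.1 hw) ⟨i, hi⟩
    have h4 : u i ⬝ᵥ Q.mulVec v = 0 := this
    rw [Matrix.mulVec_smul, dotProduct_smul, h4, smul_zero]

lemma Matrix.IsHermitian.rank_one_sub {n : ℕ} {P : Matrix (Fin n) (Fin n) ℝ}
    (hP : P.IsHermitian) : (1 - P).rank = Fintype.card {i // hP.eigenvalues i ≠ 1} := by
  have h : (1 - P) = Unitary.conjStarAlgAut ℝ _ hP.eigenvectorUnitary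
      (Matrix.diagonal fun i => 1 - hP.eigenvalues i) := by
    conv_lhs => rw [hP.spectral_theorem]
    rw [← map_one (Unitary.conjStarAlgAut ℝ _ hP.eigenvectorUnitary), ← map_sub,
      ← Matrix.diagonal_one, Matrix.diagonal_sub]
    rfl
  have h2 : (1 - P).rank = (Matrix.diagonal fun i => 1 - hP.eigenvalues i).rank := by
    rw [h, Unitary.conjStarAlgAut_apply, ← Unitary.coe_star]
    simp [-isUnit_iff_ne_zero, -Unitary.coe_star, Matrix.rank_diagonal]
  rw [h2, Matrix.rank_diagonal]
  refine Fintype.card_congr (Equiv.subtypeEquivRight fun i => ?_)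
  rw [sub_ne_zero, ne_comm]

/-- In the Fantope, `rank P > k` forces `rank (1 - P) > n - k`. -/
lemma lt_rank_one_sub_of_mem_fantope {n k : ℕ} {P : Matrix (Fin n) (Fin n) ℝ}
    (hP : P ∈ fantope n k) (h : k < P.rank) : n - k < (1 - P).rank := by
  classical
  obtain ⟨-, hpsd, -, htr⟩ := hP
  -- Otherwise at least `k` eigenvalues equal 1 and exhaust the trace, yet more than `k` are
  -- nonzero, so another positive one exists.
  by_contra! hle
  rw [hpsd.1.rank_one_sub, Fintype.card_subtype] at hle
  rw [hpsd.1.rank_eq_card_non_zero_eigs, Fintype.card_subtype] at h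
  set l := hpsd.1.eigenvalues with hl
  have hnn : ∀ i, 0 ≤ l i := hpsd.eigenvalues_nonneg
  have htr' : ∑ i, l i = k := by
    rw [← htr, hpsd.1.trace_eq_sum_eigenvalues]; simp [hl]
  have hcard := Finset.card_filter_add_card_filter_not (s := Finset.univ) (fun i => l i = 1)
  rw [Finset.card_univ, Fintype.card_fin] at hcard
  have hk : k ≤ (Finset.univ.filter fun i => l i = 1).card := by
    change _ + (Finset.univ.filter fun i => l i ≠ 1).card = n at hcard
    have := h.trans_le (Finset.card_le_univ _)
    rw [Fintype.card_fin] at this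
    omega
  have hsum : ∑ j ∈ Finset.univ.filter (fun i => l i = 1), l j
      = ((Finset.univ.filter fun i => l i = 1).card : ℝ) := by
    rw [Finset.card_eq_sum_ones, Nat.cast_sum]
    exact Finset.sum_congr rfl fun i hi => by simp [(Finset.mem_filter.1 hi).2]
  have hlt : (Finset.univ.filter fun i => l i = 1).card < (Finset.univ.filter fun i => l i ≠ 0).card := by
    refine lt_of_le_of_lt ?_ h
    have h3 : ((Finset.univ.filter fun i => l i = 1).card : ℝ) ≤ k := by
      rw [← htr', ← hsum]
      exact Finset.sum_le_sum_of_subset_of_nonneg (Finset.subset_univ _) fun i _ _ => hnn i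
    exact_mod_cast h3
  obtain ⟨i, hi1, hi2⟩ := Finset.exists_mem_notMem_of_card_lt_card hlt
  simp only [Finset.mem_filter, Finset.mem_univ, true_and] at hi1 hi2
  have h4 : l i + ∑ j ∈ Finset.univ.filter (fun i => l i = 1), l j ≤ ∑ j, l j := by
    rw [← Finset.sum_insert (by simpa using hi2)]
    exact Finset.sum_le_sum_of_subset_of_nonneg (Finset.subset_univ _) fun i _ _ => hnn i
  have h5 : (k : ℝ) ≤ ((Finset.univ.filter fun i => l i = 1).card : ℝ) := by exact_mod_cast hk
  have h6 := (hnn i).lt_of_ne (Ne.symm hi1)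
  linarith

lemma OrthonormalBasis.dotProduct_eq_ite {n : ℕ}
    (u : OrthonormalBasis (Fin n) ℝ (EuclideanSpace ℝ (Fin n))) (i j : Fin n) :
    (u i).ofLp ⬝ᵥ (u j).ofLp = if i = j then 1 else 0 := by
  have h := orthonormal_iff_ite.1 u.orthonormal j i
  rw [EuclideanSpace.inner_eq_star_dotProduct, star_trivial] at h
  simpa [eq_comm] using h

lemma OrthonormalBasis.sum_sq_dotProduct {n : ℕ}
    (u : OrthonormalBasis (Fin n) ℝ (EuclideanSpace ℝ (Fin n))) (x : Fin n → ℝ) :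
    ∑ i, ((u i).ofLp ⬝ᵥ x) ^ 2 = x ⬝ᵥ x := by
  have h := u.sum_inner_mul_inner (WithLp.toLp 2 x) (WithLp.toLp 2 x)
  simp only [EuclideanSpace.inner_eq_star_dotProduct, star_trivial] at h
  rw [← h]
  refine Finset.sum_congr rfl fun i _ => ?_
  rw [dotProduct_comm x, sq]

lemma IsEigenDecomp.traceInner_vecMulVec_self {n : ℕ} {A : Matrix (Fin n) (Fin n) ℝ} {γ : ℕ → ℝ}
    {u : OrthonormalBasis (Fin n) ℝ (EuclideanSpace ℝ (Fin n))} (h : IsEigenDecomp A γ u)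
    (x : Fin n → ℝ) :
    traceInner A (Matrix.vecMulVec x x) = ∑ i : Fin n, γ (i + 1) * ((u i).ofLp ⬝ᵥ x) ^ 2 := by
  rw [traceInner_comm, h.2, map_sum]
  refine Finset.sum_congr rfl fun i _ => ?_
  rw [map_smul, smul_eq_mul, traceInner_vecMulVec, dotProduct_vecMulVec_self_mulVec, dotProduct_comm]

/-- A maximizer over the Fantope of a linear functional close to one with an eigenvalue gap
has low rank. -/
lemma rank_le_of_traceInner_le {n k s : ℕ} (hk : 1 ≤ k) (hks : k ≤ s) (hsn : s + 1 ≤ n)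
    {A M P : Matrix (Fin n) (Fin n) ℝ} {μ : ℕ → ℝ} (hA : AreEigenvalues A μ)
    (hgap : μ (s + 1) < μ k) (hM : ‖A - M‖ ≤ (μ k - μ (s + 1)) / 2)
    (hP : P ∈ fantope n k) (hmax : ∀ Z ∈ fantope n k, traceInner M (Z - P) ≤ 0) :
    P.rank ≤ s := by
  obtain ⟨u, hu⟩ := hA
  by_contra! hlt
  have hlt' := lt_rank_one_sub_of_mem_fantope hP (hks.trans_lt hlt)
  -- `u i` is indexed from 0 and belongs to `μ (i + 1)`: `P v` avoids the top `s` eigenvectors, and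
  -- `(1 - P) y` below avoids all but the top `k`.
  obtain ⟨v, hv1, hv⟩ := exists_mulVec_orthogonal P (fun i => (u i).ofLp)
    (Finset.univ.filter fun i : Fin n => (i : ℕ) < s) (by
      rw [Fin.card_filter_val_lt]; omega)
  obtain ⟨y, hy1, hy⟩ := exists_mulVec_orthogonal (1 - P) (fun i => (u i).ofLp)
    (Finset.univ.filter fun i : Fin n => k ≤ (i : ℕ)) (by
      have := Finset.card_filter_add_card_filter_not (s := Finset.univ)
        (fun i : Fin n => (i : ℕ) < k)
      simp only [not_lt] at this
      rw [Fin.card_filter_val_lt, Finset.card_univ, Fintype.card_fin] at this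
      omega)
  obtain ⟨hP1, hP2, hP3, hP4⟩ := hP
  set c := v ⬝ᵥ P.mulVec v
  set d := y ⬝ᵥ (1 - P).mulVec y
  have hc : 0 ≤ c := by simpa using hP2.dotProduct_mulVec_nonneg v
  have hd : 0 ≤ d := by simpa using hP3.dotProduct_mulVec_nonneg y
  obtain ⟨ε, hε, hεc, hεd⟩ : ∃ ε : ℝ, 0 < ε ∧ ε * (c + 1) ≤ 1 ∧ ε * (d + 1) ≤ 1 := by
    refine ⟨(c + d + 1)⁻¹, by positivity, ?_, ?_⟩
    all_goals
      rw [inv_mul_le_iff₀ (by positivity)]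
      linarith
  have hw := hP2.sub_smul_vecMulVec_mulVec v hεc
  have hz := hP3.sub_smul_vecMulVec_mulVec y hεd
  set w := P.mulVec v
  set z := (1 - P).mulVec y
  have hmem : P + ε • (Matrix.vecMulVec z z - Matrix.vecMulVec w w) ∈ fantope n k := by
    refine ⟨hP1.add (((isSymm_vecMulVec_self z).sub (isSymm_vecMulVec_self w)).smul ε), ?_, ?_, ?_⟩
    · have := hw.add ((posSemidef_vecMulVec_self z).smul hε.le)
      convert this using 1
      rw [smul_sub]; abel
    · have := hz.add ((posSemidef_vecMulVec_self w).smul hε.le)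
      convert this using 1
      rw [smul_sub]; abel
    · rw [Matrix.trace_add, Matrix.trace_smul, Matrix.trace_sub, Matrix.trace_vecMulVec,
        Matrix.trace_vecMulVec, hv1, hy1, sub_self, smul_zero, add_zero, hP4]
  have h1 := hmax _ hmem
  rw [add_sub_cancel_left, map_smul, smul_eq_mul] at h1
  have h2 : traceInner M (Matrix.vecMulVec z z - Matrix.vecMulVec w w) ≤ 0 :=
    nonpos_of_mul_nonpos_right h1 hε
  have hAz : μ k ≤ traceInner A (Matrix.vecMulVec z z) := by
    rw [hu.traceInner_vecMulVec_self, ← mul_one (μ k), ← hy1, ← u.sum_sq_dotProduct, Finset.mul_sum]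
    refine Finset.sum_le_sum fun i _ => ?_
    by_cases hi : k ≤ (i : ℕ)
    · rw [hy i (by simpa using hi)]; simp
    · exact mul_le_mul_of_nonneg_right
        (hu.1 ⟨by omega, by omega⟩ ⟨by omega, by omega⟩ (by omega)) (sq_nonneg _)
  have hAw : traceInner A (Matrix.vecMulVec w w) ≤ μ (s + 1) := by
    rw [hu.traceInner_vecMulVec_self, ← mul_one (μ (s + 1)), ← hv1, ← u.sum_sq_dotProduct,
      Finset.mul_sum]
    refine Finset.sum_le_sum fun i _ => ?_
    by_cases hi : (i : ℕ) < s
    · rw [hv i (by simpa using hi)]; simp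
    · exact mul_le_mul_of_nonneg_right
        (hu.1 ⟨by omega, by omega⟩ ⟨by omega, by omega⟩ (by omega)) (sq_nonneg _)
  -- The squared norm is `2 - 2 (z ⬝ᵥ w)²`. A norm strictly below 2 is what lets half the gap
  -- suffice in `hM`.
  have hD : ‖Matrix.vecMulVec z z - Matrix.vecMulVec w w‖ ^ 2 ≤ 2 := by
    rw [sq_norm_sub, ← traceInner_self, ← traceInner_self, traceInner_vecMulVec,
      traceInner_vecMulVec, traceInner_vecMulVec, dotProduct_vecMulVec_self_mulVec,
      dotProduct_vecMulVec_self_mulVec, dotProduct_vecMulVec_self_mulVec, hv1, hy1]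
    linarith [sq_nonneg (z ⬝ᵥ w)]
  have hD' : ‖Matrix.vecMulVec z z - Matrix.vecMulVec w w‖ < 2 := by
    nlinarith [norm_nonneg (Matrix.vecMulVec z z - Matrix.vecMulVec w w)]
  have h3 := traceInner_le_norm_mul_norm (A - M) (Matrix.vecMulVec z z - Matrix.vecMulVec w w)
  rw [traceInner_sub_left, map_sub (traceInner A)] at h3
  have h4 := mul_le_mul_of_nonneg_right hM
    (norm_nonneg (Matrix.vecMulVec z z - Matrix.vecMulVec w w))
  nlinarith

/-! ### Projection onto the Fantope by clipping eigenvalues. -/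

lemma clipShift_nonneg (θ x : ℝ) : 0 ≤ clipShift θ x :=
  le_min (le_max_right _ _) zero_le_one

lemma clipShift_le_one (θ x : ℝ) : clipShift θ x ≤ 1 := min_le_right _ _

lemma clipShift_eq_zero_iff {θ x : ℝ} : clipShift θ x = 0 ↔ x ≤ θ := by
  unfold clipShift
  constructor
  · intro h
    by_contra! hlt
    have : 0 < min (max (x - θ) 0) 1 := lt_min (lt_max_of_lt_left (by linarith)) one_pos
    linarith
  · intro h
    rw [max_eq_right (by linarith), min_eq_left zero_le_one]

lemma clipShift_anti {a b : ℝ} (hab : a ≤ b) (x : ℝ) : clipShift b x ≤ clipShift a x :=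
  min_le_min_right _ (max_le_max_right _ (by linarith))

/-- The clipped value is the projection of `x - θ` onto `[0, 1]`. -/
lemma sub_clipShift_mul_nonpos (θ x : ℝ) {z : ℝ} (h0 : 0 ≤ z) (h1 : z ≤ 1) :
    (x - θ - clipShift θ x) * (z - clipShift θ x) ≤ 0 := by
  unfold clipShift
  rcases le_total (x - θ) 0 with h | h
  · rw [max_eq_right h, min_eq_left zero_le_one]; nlinarith
  · rw [max_eq_left h]
    rcases le_total (x - θ) 1 with h' | h'
    · rw [min_eq_left h']; simp
    · rw [min_eq_right h']; nlinarith

lemma exists_sum_clipShift_eq {ι : Type*} [Fintype ι] (a : ι → ℝ) {c : ℝ} (h0 : 0 ≤ c)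
    (h1 : c ≤ Fintype.card ι) : ∃ θ, ∑ i, clipShift θ (a i) = c := by
  have hcont : Continuous fun θ => ∑ i, clipShift θ (a i) := by
    unfold clipShift; fun_prop
  obtain ⟨B, hB⟩ : ∃ B, ∀ i, |a i| ≤ B :=
    ⟨∑ i, |a i|, fun i => Finset.single_le_sum (f := fun i => |a i|)
      (fun j _ => abs_nonneg _) (Finset.mem_univ i)⟩
  -- Intermediate values: at `θ = B` every term is 0, at `θ = -B - 1` every term is 1.
  refine mem_range_of_exists_le_of_exists_ge hcont ⟨B, ?_⟩ ⟨-B - 1, ?_⟩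
  · refine (Finset.sum_nonpos fun i _ => ?_).trans h0
    exact (clipShift_eq_zero_iff.2 (abs_le.1 (hB i)).2).le
  · refine h1.trans ?_
    rw [Fintype.card, Finset.card_eq_sum_ones, Nat.cast_sum]
    refine Finset.sum_le_sum fun i _ => ?_
    have := (abs_le.1 (hB i)).1
    rw [Nat.cast_one]
    exact le_min (le_max_of_le_left (by linarith)) le_rfl

lemma OrthonormalBasis.sum_vecMulVec_self {n : ℕ}
    (u : OrthonormalBasis (Fin n) ℝ (EuclideanSpace ℝ (Fin n))) :
    ∑ i, Matrix.vecMulVec (u i).ofLp (u i).ofLp = (1 : Matrix (Fin n) (Fin n) ℝ) := by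
  ext a b
  have h := u.sum_inner_mul_inner (EuclideanSpace.single a 1) (EuclideanSpace.single b 1)
  simp only [EuclideanSpace.inner_single_left, EuclideanSpace.inner_single_right] at h
  simp only [Matrix.sum_apply, Matrix.vecMulVec_apply]
  simpa [Matrix.one_apply, eq_comm] using h

lemma posSemidef_sum_smul_vecMulVec {n : ℕ} (x : Fin n → Fin n → ℝ) {c : Fin n → ℝ}
    (hc : ∀ i, 0 ≤ c i) : (∑ i, c i • Matrix.vecMulVec (x i) (x i)).PosSemidef :=
  Matrix.posSemidef_sum _ fun i _ => (posSemidef_vecMulVec_self (x i)).smul (hc i)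

lemma sum_smul_vecMulVec_mem_fantope {n k : ℕ}
    (u : OrthonormalBasis (Fin n) ℝ (EuclideanSpace ℝ (Fin n))) {c : Fin n → ℝ}
    (h0 : ∀ i, 0 ≤ c i) (h1 : ∀ i, c i ≤ 1) (hk : ∑ i, c i = k) :
    ∑ i, c i • Matrix.vecMulVec (u i).ofLp (u i).ofLp ∈ fantope n k := by
  have hpsd := posSemidef_sum_smul_vecMulVec (fun i => (u i).ofLp) h0
  refine ⟨by simpa [Matrix.IsHermitian, Matrix.IsSymm] using hpsd.1, hpsd, ?_, ?_⟩
  · have := posSemidef_sum_smul_vecMulVec (fun i => (u i).ofLp) (c := fun i => 1 - c i)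
      (fun i => by linarith [h1 i])
    simpa [sub_smul, Finset.sum_sub_distrib, u.sum_vecMulVec_self] using this
  · rw [Matrix.trace_sum, ← hk]
    refine Finset.sum_congr rfl fun i _ => ?_
    rw [Matrix.trace_smul, Matrix.trace_vecMulVec, u.dotProduct_eq_ite, if_pos rfl, smul_eq_mul,
      mul_one]

/-- The projection of a matrix onto the Fantope is obtained by clipping its eigenvalues. -/
lemma IsProjOnto.eq_sum_clipShift {n k : ℕ} {Y P : Matrix (Fin n) (Fin n) ℝ}
    (hP : IsProjOnto (fantope n k) Y P) {γ : ℕ → ℝ}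
    {u : OrthonormalBasis (Fin n) ℝ (EuclideanSpace ℝ (Fin n))} (hY : IsEigenDecomp Y γ u) {θ : ℝ}
    (hθ : ∑ i : Fin n, clipShift θ (γ (i + 1)) = k) :
    P = ∑ i : Fin n, clipShift θ (γ (i + 1)) • Matrix.vecMulVec (u i).ofLp (u i).ofLp := by
  have hmem := sum_smul_vecMulVec_mem_fantope u (fun i => clipShift_nonneg θ (γ (i + 1)))
    (fun i => clipShift_le_one _ _) hθ
  refine hP.eq_of_traceInner_nonpos hmem ?_
  rintro Z ⟨-, hZ0, hZ1, hZt⟩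
  -- `Y` and the candidate are both diagonal in the basis `u`, so only the diagonal of `Z` in that
  -- basis matters.
  set z : Fin n → ℝ := fun i => (u i).ofLp ⬝ᵥ Z.mulVec (u i).ofLp with hz
  have hz0 : ∀ i, 0 ≤ z i := fun i => by simpa using hZ0.dotProduct_mulVec_nonneg (u i).ofLp
  have hz1 : ∀ i, z i ≤ 1 := fun i => by
    have := hZ1.dotProduct_mulVec_nonneg (u i).ofLp
    rw [star_trivial, Matrix.sub_mulVec, Matrix.one_mulVec, dotProduct_sub, u.dotProduct_eq_ite,
      if_pos rfl] at this
    linarith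
  have hzs : ∑ i, z i = k := by
    rw [← hZt, ← traceInner_one, ← u.sum_vecMulVec_self, traceInner_comm, map_sum]
    exact Finset.sum_congr rfl fun i _ => (traceInner_vecMulVec _ _ _).symm
  have hcoef : ∀ i, traceInner (∑ j : Fin n, clipShift θ (γ (j + 1)) •
      Matrix.vecMulVec (u j).ofLp (u j).ofLp) (Matrix.vecMulVec (u i).ofLp (u i).ofLp)
      = clipShift θ (γ (i + 1)) := by
    intro i
    rw [traceInner_comm, map_sum, Finset.sum_eq_single i]
    · rw [map_smul, traceInner_vecMulVec, dotProduct_vecMulVec_self_mulVec, u.dotProduct_eq_ite]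
      simp
    · intro j _ hj
      rw [map_smul, traceInner_vecMulVec, dotProduct_vecMulVec_self_mulVec, u.dotProduct_eq_ite,
        if_neg hj.symm]
      simp
    · simp
  have hexp : ∀ W, traceInner (Y - ∑ j : Fin n, clipShift θ (γ (j + 1)) •
      Matrix.vecMulVec (u j).ofLp (u j).ofLp) W = ∑ i : Fin n,
        (γ (i + 1) - clipShift θ (γ (i + 1))) *
          traceInner W (Matrix.vecMulVec (u i).ofLp (u i).ofLp) := by
    intro W
    conv_lhs => rw [hY.2]
    rw [← Finset.sum_sub_distrib, traceInner_comm, map_sum]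
    refine Finset.sum_congr rfl fun i _ => ?_
    rw [← sub_smul, map_smul, smul_eq_mul]
  rw [hexp]
  calc _ = ∑ i : Fin n, (γ (i + 1) - clipShift θ (γ (i + 1))) *
        (z i - clipShift θ (γ (i + 1))) := by
        refine Finset.sum_congr rfl fun i _ => ?_
        rw [traceInner_sub_left, hcoef, traceInner_vecMulVec]
    -- `θ` acts as the multiplier of the trace constraint: both sequences sum to `k`, so the shift
    -- is free.
    _ = ∑ i : Fin n, (γ (i + 1) - θ - clipShift θ (γ (i + 1))) *
        (z i - clipShift θ (γ (i + 1))) + θ * (∑ i, z i - ∑ i : Fin n, clipShift θ (γ (i + 1))) := by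
        rw [← Finset.sum_sub_distrib, Finset.mul_sum, ← Finset.sum_add_distrib]
        exact Finset.sum_congr rfl fun i _ => by ring
    _ ≤ 0 := by
        rw [hzs, hθ, sub_self, mul_zero, add_zero]
        exact Finset.sum_nonpos fun i _ => sub_clipShift_mul_nonpos _ _ (hz0 i) (hz1 i)

lemma card_le_rank_sum_smul_vecMulVec {n : ℕ}
    (u : OrthonormalBasis (Fin n) ℝ (EuclideanSpace ℝ (Fin n))) (c : Fin n → ℝ) (S : Finset (Fin n))
    (hS : ∀ i ∈ S, c i ≠ 0) :
    S.card ≤ (∑ i, c i • Matrix.vecMulVec (u i).ofLp (u i).ofLp).rank := by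
  set Q := ∑ i, c i • Matrix.vecMulVec (u i).ofLp (u i).ofLp with hQ
  have heig : ∀ i, Q.mulVec (u i).ofLp = c i • (u i).ofLp := by
    intro i
    rw [hQ, Matrix.sum_mulVec, Finset.sum_eq_single i]
    · rw [Matrix.smul_mulVec, Matrix.vecMulVec_mulVec, u.dotProduct_eq_ite]
      simp
    · intro j _ hj
      rw [Matrix.smul_mulVec, Matrix.vecMulVec_mulVec, u.dotProduct_eq_ite, if_neg hj]
      simp
    · simp
  have hmem : ∀ i : S, (u i).ofLp ∈ LinearMap.range Q.mulVecLin := fun i =>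
    ⟨(c i)⁻¹ • (u i).ofLp, by
      rw [Matrix.mulVecLin_apply, Matrix.mulVec_smul, heig, smul_smul,
        inv_mul_cancel₀ (hS i i.2), one_smul]⟩
  have hli : LinearIndependent ℝ fun i : Fin n => (u i).ofLp :=
    u.orthonormal.linearIndependent.map' (WithLp.linearEquiv 2 ℝ (Fin n → ℝ)).toLinearMap
      (LinearEquiv.ker _)
  have hli' : LinearIndependent ℝ
      (fun i : S => (⟨(u i).ofLp, hmem i⟩ : LinearMap.range Q.mulVecLin)) := by
    refine LinearIndependent.of_comp (LinearMap.range Q.mulVecLin).subtype ?_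
    exact hli.comp (fun i : S => (i : Fin n)) Subtype.val_injective
  have := hli'.fintype_card_le_finrank
  rwa [Fintype.card_coe] at this

/-- A low-rank projection onto the Fantope is computed from the leading eigenpairs alone. -/
lemma IsProjOnto.computedFromLeading {n k s : ℕ} {Y P : Matrix (Fin n) (Fin n) ℝ}
    (hP : IsProjOnto (fantope n k) Y P) (hks : k ≤ s) (hsn : s + 1 ≤ n) (hrank : P.rank ≤ s) :
    ComputedFromLeading k s Y P := by
  intro γ u hY
  obtain ⟨θ₀, hθ₀⟩ := exists_sum_clipShift_eq (fun i : Fin n => γ (i + 1)) (c := (k : ℝ))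
    (Nat.cast_nonneg k) (by rw [Fintype.card_fin]; exact_mod_cast by omega)
  have hP' := hP.eq_sum_clipShift hY hθ₀
  -- Otherwise `s + 1` clipped eigenvalues would be positive, exceeding the rank.
  have hle : γ (s + 1) ≤ θ₀ := by
    by_contra! hlt
    have h1 := card_le_rank_sum_smul_vecMulVec u (fun i : Fin n => clipShift θ₀ (γ (i + 1)))
      (Finset.univ.filter fun i : Fin n => (i : ℕ) < s + 1) (by
        intro i hi
        have hi' : (i : ℕ) < s + 1 := by simpa using hi
        rw [Ne, clipShift_eq_zero_iff, not_le]
        exact hlt.trans_le (hY.1 ⟨by omega, by omega⟩ ⟨by omega, by omega⟩ (by omega)))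
    rw [← hP', Fin.card_filter_val_lt] at h1
    omega
  have hzero : ∀ i : Fin n, ¬ ((i : ℕ) + 1 ≤ s) → clipShift θ₀ (γ (i + 1)) = 0 := fun i hi =>
    clipShift_eq_zero_iff.2
      ((hY.1 ⟨by omega, by omega⟩ ⟨by omega, by omega⟩ (by omega)).trans hle)
  have hsum : ∑ i ∈ Finset.univ.filter (fun i : Fin n => (i : ℕ) + 1 ≤ s),
      clipShift θ₀ (γ (i + 1)) = k := by
    rw [← hθ₀]
    refine Finset.sum_subset (Finset.subset_univ _) fun i _ hi => hzero i (by simpa using hi)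
  have hPs : P = ∑ i ∈ Finset.univ.filter (fun i : Fin n => (i : ℕ) + 1 ≤ s),
      clipShift θ₀ (γ (i + 1)) • Matrix.vecMulVec (u i).ofLp (u i).ofLp := by
    rw [hP']
    refine (Finset.sum_subset (Finset.subset_univ _) fun i _ hi => ?_).symm
    rw [hzero i (by simpa using hi), zero_smul]
  refine ⟨⟨θ₀, hsum⟩, fun θ hθ => ?_⟩
  -- `θ` need not be unique, but each term is antitone in it, so equal sums force equal terms.
  have hterm : ∀ i ∈ Finset.univ.filter (fun i : Fin n => (i : ℕ) + 1 ≤ s),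
      clipShift θ₀ (γ (i + 1)) = clipShift θ (γ (i + 1)) := by
    rcases le_total θ₀ θ with h | h
    · exact fun i hi => ((Finset.sum_eq_sum_iff_of_le fun (i : Fin n) _ =>
        clipShift_anti h (γ (i + 1))).1 (hθ.trans hsum.symm) i hi).symm
    · exact (Finset.sum_eq_sum_iff_of_le fun (i : Fin n) _ =>
        clipShift_anti h (γ (i + 1))).1 (hsum.trans hθ.symm)
  rw [hPs]
  exact Finset.sum_congr rfl fun i hi => by rw [hterm i hi]

/-! ### The residual bound and the theorem. -/

/-- For projected gradient steps, the residual moves by at most `2 β` times the distance to the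
minimizer. -/
lemma norm_residual_le {n : ℕ}
    {G : Matrix (Fin n) (Fin n) ℝ → Matrix (Fin n) (Fin n) ℝ} {β : ℝ} (hβ : 0 < β)
    (hlip : ∀ X ∈ symMatrices n, ∀ Y ∈ symMatrices n, ‖G X - G Y‖ ≤ β * ‖X - Y‖)
    {S : Set (Matrix (Fin n) (Fin n) ℝ)} (hS : Convex ℝ S) (hSs : S ⊆ symMatrices n)
    {Xs X P : Matrix (Fin n) (Fin n) ℝ} (hXs : Xs ∈ S) (hX : X ∈ S)
    (hopt : ∀ Z ∈ S, 0 ≤ traceInner (G Xs) (Z - Xs))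
    (hP : IsProjOnto S (X - β⁻¹ • G X) P) :
    ‖-(G Xs) - β • (X - β⁻¹ • G X - P)‖ ≤ 2 * β * ‖X - Xs‖ := by
  set D := β • (X - β⁻¹ • G X - P) + G Xs with hD
  have h1 := hP.traceInner_nonpos hS hXs
  have h2 := hopt P hP.1
  have h3 : 0 ≤ traceInner D (β • (P - Xs)) := by
    rw [hD, map_smul, smul_eq_mul, traceInner_add_left, traceInner_smul_left]
    refine mul_nonneg hβ.le (add_nonneg ?_ h2)
    refine mul_nonneg hβ.le ?_
    rw [← neg_sub Xs P, map_neg]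
    linarith
  -- Adding `β (P - Xs)` eliminates `P`; by `h3` it cannot shorten `D`.
  have h4 : D + β • (P - Xs) = β • (X - Xs) - (G X - G Xs) := by
    rw [hD, smul_sub, smul_sub, smul_smul, mul_inv_cancel₀ hβ.ne', one_smul, smul_sub, smul_sub]
    abel
  have h5 : ‖D‖ ≤ ‖D + β • (P - Xs)‖ := by
    refine le_of_sq_le_sq ?_ (norm_nonneg _)
    rw [sq_norm_add D (β • (P - Xs))]
    linarith [sq_nonneg ‖β • (P - Xs)‖]
  have h6 : -(G Xs) - β • (X - β⁻¹ • G X - P) = -D := by rw [hD]; abel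
  rw [h6, norm_neg]
  refine h5.trans ?_
  rw [h4]
  refine (norm_sub_le _ _).trans ?_
  rw [norm_smul, Real.norm_of_nonneg hβ.le]
  linarith [hlip X (hSs hX) Xs (hSs hXs)]

theorem theorem6 :
    ∃ C : ℝ, 0 < C ∧
      ∀ (n k : ℕ) (β : ℝ) (f : Matrix (Fin n) (Fin n) ℝ → ℝ)
        (G : Matrix (Fin n) (Fin n) ℝ → Matrix (Fin n) (Fin n) ℝ)
        (Xs : Matrix (Fin n) (Fin n) ℝ) (μ : ℕ → ℝ) (r : ℕ),
        1 ≤ k → 0 < β →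
        ConvexOn ℝ (symMatrices n) f →
        IsSymGradient f G →
        (∀ X ∈ symMatrices n, ∀ Y ∈ symMatrices n, ‖G X - G Y‖ ≤ β * ‖X - Y‖) →
        Xs ∈ fantope n k →
        IsMinOn f (fantope n k) Xs →
        AreEigenvalues (-(G Xs)) μ →
        IsLeast {j : ℕ | k ≤ j ∧ j + 1 ≤ n ∧ 0 < μ j - μ (j + 1)} r →
        Xs.rank ≤ r ∧
        ∀ r' : ℕ, r ≤ r' → r' + 1 ≤ n →
          ∀ X : ℕ → Matrix (Fin n) (Fin n) ℝ,
            X 1 ∈ fantope n k →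
            (∀ t : ℕ, 1 ≤ t → IsProjOnto (fantope n k) (X t - β⁻¹ • G (X t)) (X (t + 1))) →
            ‖X 1 - Xs‖ ≤ (μ k - μ (r' + 1)) / (4 * β) →
            (∀ t : ℕ, 1 ≤ t →
              (X (t + 1)).rank ≤ r' ∧
              ComputedFromLeading k r' (X t - β⁻¹ • G (X t)) (X (t + 1))) ∧
            (∀ t : ℕ, 2 ≤ t →
              f (X t) - f Xs ≤ C * (β * ‖X 1 - Xs‖ ^ 2 / (t : ℝ))) := by
  refine ⟨1, one_pos, ?_⟩
  intro n k β f G Xs μ r hk hβ hf hG hlip hXs hmin hμ hr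
  have hS := convex_fantope n k
  have hSs := fantope_subset_symMatrices n k
  obtain ⟨⟨hkr, hrn, hgap⟩, -⟩ := hr
  have hanti : AntitoneOn μ (Set.Icc 1 n) := hμ.choose_spec.1
  have hopt : ∀ Z ∈ fantope n k, 0 ≤ traceInner (G Xs) (Z - Xs) := fun Z hZ =>
    hG.traceInner_nonneg_of_isMinOn hS hSs hmin hXs hZ
  have hgap' : ∀ s, r ≤ s → s + 1 ≤ n → μ (s + 1) < μ k := fun s hs hsn => by
    have h1 := hanti ⟨hk, by omega⟩ ⟨by omega, by omega⟩ hkr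
    have h2 := hanti ⟨by omega, hrn⟩ ⟨by omega, hsn⟩ (show r + 1 ≤ s + 1 by omega)
    linarith
  refine ⟨?_, ?_⟩
  · refine rank_le_of_traceInner_le hk hkr hrn hμ (hgap' r le_rfl hrn) ?_ hXs
      (M := -(G Xs)) fun Z hZ => ?_
    · rw [sub_self, norm_zero]
      linarith [hgap' r le_rfl hrn]
    · rw [traceInner_neg_left]
      linarith [hopt Z hZ]
  intro r' hrr' hr'n X hX1 hX hdist
  have hpot := projected_gradient_potential_le hG hf hβ hlip hS hSs hXs hX1 hX
  have hge : ∀ t, f Xs ≤ f (X (t + 1)) := fun t => hmin (hpot t).1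
  refine ⟨fun t ht => ?_, fun t ht => ?_⟩
  · obtain ⟨t, rfl⟩ := Nat.exists_eq_add_of_le' ht
    obtain ⟨hXt, hdec⟩ := hpot t
    have hP := hX (t + 1) ht
    have hle : ‖X (t + 1) - Xs‖ ≤ ‖X 1 - Xs‖ := by
      refine le_of_sq_le_sq ?_ (norm_nonneg _)
      have := mul_nonneg (Nat.cast_nonneg (α := ℝ) t) (sub_nonneg.2 (hge t))
      exact le_of_mul_le_mul_left (by linarith) (half_pos hβ)
    have hrank : (X (t + 1 + 1)).rank ≤ r' := by
      -- The radius `gap / (4β)` times the factor `2β` is exactly half the gap.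
      refine rank_le_of_traceInner_le hk (hkr.trans hrr') hr'n hμ (hgap' r' hrr' hr'n)
        ((norm_residual_le hβ hlip hS hSs hXs hXt hopt hP).trans ?_) hP.1 fun Z hZ => ?_
      · rw [le_div_iff₀ (by positivity)] at hdist
        have := mul_le_mul_of_nonneg_left hle hβ.le
        linarith
      · rw [traceInner_smul_left]
        exact mul_nonpos_of_nonneg_of_nonpos hβ.le (hP.traceInner_nonpos hS hZ)
    exact ⟨hrank, hP.computedFromLeading (hkr.trans hrr') hr'n hrank⟩
  · obtain ⟨t, rfl⟩ := Nat.exists_eq_add_of_le' ht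
    have h1 := (hpot (t + 1)).2
    have h2 : 0 ≤ β / 2 * ‖X (t + 1 + 1) - Xs‖ ^ 2 := by positivity
    -- With the time written as `t + 2`, the potential bounds `2 (t + 1)` times the error; `t + 2 ≤
    -- 2 (t + 1)` gives `C = 1`.
    have h3 := mul_nonneg (Nat.cast_nonneg (α := ℝ) t) (sub_nonneg.2 (hge (t + 1)))
    rw [one_mul, le_div_iff₀ (by positivity)]
    push_cast at h1 ⊢
    change (f (X (t + 1 + 1)) - f Xs) * _ ≤ _
    linarith
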